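/- Let $\mathbb{R}_\infty=\mathbb{R}\cup\{\infty\}$. A function $\Psi:\mathbb{R}^{3\times3}\to\mathbb{R}_\infty$ is called polyconvex if there is a convex, lower semicontinuous $\widehat\Psi:\mathbb{R}^{3\times3}\times\mathbb{R}^{3\times3}\times\mathbb{R}\to\mathbb{R}_\infty$ with $\Psi(F)=\widehat\Psi(F,\operatorname{cof}F,\det F)$ for all $F\in\mathbb{R}^{3\times3}$. A function $\Psi^{inc}:\{F\in\mathbb{R}^{3\times3}\mid\det F=1\}\to\mathbb{R}_\infty$ is called polyconvex if its extension to $\mathbb{R}^{3\times3}$ by the value $\infty$ on $\{\det F\neq1\}$ is polyconvex. Let $$\Pi_3=\{B\,\mathrm{diag}(\epsilon)\mid B \text{ a } 3\times3 \text{ permutation matrix},\ \epsilon\in\{-1,1\}^3,\ \epsilon_1\epsilon_2\epsilon_3=1\}.$$ A function $\widetilde\Psi^{inc}:\{\nu\in\mathbb{R}^3\mid\nu_1\nu_2\nu_3=1\}\to\mathbb{R}_\infty$ is $\Pi_3$-invariant if $\widetilde\Psi^{inc}(P\nu)=\widetilde\Psi^{inc}(\nu)$ for all $P\in\Pi_3$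 and all $\nu$. Such a function determines a function $\Psi^{inc}$ on $\{\det F=1\}$ by $\Psi^{inc}(F)=\widetilde\Psi^{inc}(\nu)$, where $\nu$ is any triple of signed singular values of $F$, i.e. $F=R_1\,\mathrm{diag}(\nu)\,R_2$ with $R_1,R_2\in SO(3)$; $\widetilde\Psi^{inc}$ is called singular value polyconvex if $\Psi^{inc}$ is polyconvex. Then a $\Pi_3$-invariant function $\widetilde\Psi^{inc}:\{\nu\in\mathbb{R}^3\mid\nu_1\nu_2\nu_3=1\}\to\mathbb{R}_\infty$ is singular value polyconvex if and only if there exists a convex, lower semicontinuous function $\Psi^{inc}_{ssv}:\mathbb{R}^6\to\mathbb{R}_\infty$ such that $$\widetilde\Psi^{inc}(\nu_1,\nu_2,\nu_3)=\Psi^{inc}_{ssv}(\nu_1,\nu_2,\nu_3,\nu_2\nu_3,\nu_1\nu_3,\nu_1\nu_2)\qquad\text{for all }\nu\in\mathbb{R}^3\text{ with }\nu_1\nu_2\nu_3=1.$$ -/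

import Mathlib

open Matrix

noncomputable section

/-- `ℝ_∞ = ℝ ∪ {∞}`, with the usual order and the usual arithmetic of `∞`. -/
abbrev RInf : Type := WithTop ℝ

/-- Convexity of a function with values in `ℝ ∪ {∞}`. -/
def ConvexRInf {E : Type*} [AddCommMonoid E] [SMul ℝ E] (f : E → RInf) : Prop :=
  ∀ x y : E, ∀ a b : ℝ, 0 < a → 0 < b → a + b = 1 →
    f (a • x + b • y) ≤ (a : RInf) * f x + (b : RInf) * f y

/-- Real `3 × 3` matrices. -/
abbrev Mat3 : Type := Matrix (Fin 3) (Fin 3) ℝ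

/-- The cofactor matrix, i.e. the transpose of the adjugate. -/
def cof (F : Mat3) : Mat3 := (adjugate F)ᵀ

/-- `Ψ(F) = Ψ̂(F, cof F, det F)` with a convex and lower semicontinuous `Ψ̂`. -/
def Polyconvex (Ψ : Mat3 → RInf) : Prop :=
  ∃ Ψhat : Mat3 × Mat3 × ℝ → RInf,
    ConvexRInf Ψhat ∧ LowerSemicontinuous Ψhat ∧ ∀ F : Mat3, Ψ F = Ψhat (F, cof F, F.det)

/-- The deformation gradients `F` with `det F = 1`. -/
abbrev IncMat : Type := {F : Mat3 // F.det = 1}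

/-- The extension by `∞` to all `3 × 3` matrices of a function defined on `{det F = 1}`. -/
def extendByTop (Ψinc : IncMat → RInf) (F : Mat3) : RInf :=
  open Classical in if h : F.det = 1 then Ψinc ⟨F, h⟩ else ⊤

/-- A function on `{det F = 1}` is polyconvex if its extension by `∞` is polyconvex. -/
def IncPolyconvex (Ψinc : IncMat → RInf) : Prop :=
  Polyconvex (extendByTop Ψinc)

/-- The triples `ν ∈ ℝ³` with `ν₁ ν₂ ν₃ = 1`. -/
abbrev IncSV : Type := {ν : Fin 3 → ℝ // ν 0 * ν 1 * ν 2 = 1}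

/-- The group `Π₃` of the matrices `B · diag ε` with `B` a permutation matrix,
`ε ∈ {-1, 1}³` and `ε₁ ε₂ ε₃ = 1`. -/
def Pi3 : Set Mat3 :=
  {P | ∃ (σ : Equiv.Perm (Fin 3)) (ε : Fin 3 → ℝ), (∀ i, ε i = 1 ∨ ε i = -1) ∧
    ε 0 * ε 1 * ε 2 = 1 ∧ P = σ.permMatrix ℝ * diagonal ε}

/-- `Π₃` maps `{ν₁ ν₂ ν₃ = 1}` into itself. -/
theorem Pi3.mulVec_mem {P : Mat3} (hP : P ∈ Pi3) (ν : IncSV) :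
    (P *ᵥ ν.1) 0 * (P *ᵥ ν.1) 1 * (P *ᵥ ν.1) 2 = 1 := by
  obtain ⟨σ, ε, -, hε, rfl⟩ := hP
  have key : ∀ i, ((σ.permMatrix ℝ * diagonal ε) *ᵥ ν.1) i = ε (σ i) * ν.1 (σ i) := by
    intro i
    rw [← mulVec_mulVec, permMatrix_mulVec]
    simp [mulVec_diagonal]
  have h2 : ∏ i, ε (σ i) * ν.1 (σ i) = ∏ i, ε i * ν.1 i :=
    Equiv.prod_comp σ (fun i => ε i * ν.1 i)
  rw [key, key, key, ← Fin.prod_univ_three (fun i => ε (σ i) * ν.1 (σ i)), h2,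
    Fin.prod_univ_three]
  linear_combination (ν.1 0 * ν.1 1 * ν.1 2) * hε + ν.2

/-- Invariance of a function on `{ν₁ ν₂ ν₃ = 1}` under `Π₃`. -/
def Pi3Invariant (Ψt : IncSV → RInf) : Prop :=
  ∀ (P : Mat3) (hP : P ∈ Pi3) (ν : IncSV), Ψt ⟨P *ᵥ ν.1, Pi3.mulVec_mem hP ν⟩ = Ψt ν

/-- `ν` is a triple of signed singular values of `F`: `F = R₁ diag(ν) R₂` with
`R₁, R₂ ∈ SO(3)`. -/
def IsSignedSV (F : Mat3) (ν : Fin 3 → ℝ) : Prop :=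
  ∃ R₁ ∈ specialOrthogonalGroup (Fin 3) ℝ, ∃ R₂ ∈ specialOrthogonalGroup (Fin 3) ℝ,
    F = R₁ * diagonal ν * R₂

theorem mem_SO3_iff {R : Mat3} :
    R ∈ specialOrthogonalGroup (Fin 3) ℝ ↔ Rᵀ * R = 1 ∧ R.det = 1 := by
  rw [mem_specialOrthogonalGroup_iff, mem_orthogonalGroup_iff']

/-- Every matrix of determinant `1` has signed singular values, and their product is `1`. -/
theorem exists_signedSV (F : IncMat) : ∃ ν : IncSV, IsSignedSV F.1 ν.1 := by
  obtain ⟨F, hF⟩ := F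
  have hu : IsUnit F := (isUnit_iff_isUnit_det F).2 (by simp [hF])
  have hpd : (Fᵀ * F).PosDef := by
    have := PosDef.conjTranspose_mul_self F (mulVec_injective_of_isUnit hu)
    simpa [conjTranspose_eq_transpose_of_trivial] using this
  set V : Mat3 := (hpd.1.eigenvectorUnitary : Mat3) with hV
  set μ := hpd.1.eigenvalues with hμ
  have hμpos : ∀ i, 0 < μ i := hpd.eigenvalues_pos
  have hVV : Vᵀ * V = 1 := by
    have := (Matrix.mem_orthogonalGroup_iff' (Fin 3) ℝ).1 hpd.1.eigenvectorUnitary.2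
    simpa using this
  have hVV' : V * Vᵀ = 1 := mul_eq_one_comm.1 hVV
  have hspec : Fᵀ * F = V * diagonal μ * Vᵀ := by
    have := hpd.1.spectral_theorem
    rw [Unitary.conjStarAlgAut_apply] at this
    simpa [star_eq_conjTranspose, conjTranspose_eq_transpose_of_trivial, Function.comp_def]
      using this
  set s : Fin 3 → ℝ := fun i => Real.sqrt (μ i) with hs
  have hspos : ∀ i, 0 < s i := fun i => Real.sqrt_pos.2 (hμpos i)
  have hss : ∀ i, s i * s i = μ i := fun i => Real.mul_self_sqrt (hμpos i).le
  set U : Mat3 := F * V * diagonal (fun i => (s i)⁻¹) with hU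
  have hUU : Uᵀ * U = 1 := by
    have e1 : Uᵀ * U = diagonal (fun i => (s i)⁻¹) * (Vᵀ * (Fᵀ * F) * V) *
        diagonal (fun i => (s i)⁻¹) := by
      simp only [hU, transpose_mul, diagonal_transpose, Matrix.mul_assoc]
    have e2 : Vᵀ * (V * diagonal μ * Vᵀ) * V = diagonal μ := by
      calc Vᵀ * (V * diagonal μ * Vᵀ) * V = (Vᵀ * V) * diagonal μ * (Vᵀ * V) := by
            simp only [Matrix.mul_assoc]
        _ = diagonal μ := by rw [hVV]; simp
    rw [e1, hspec, e2, diagonal_mul_diagonal, diagonal_mul_diagonal, ← diagonal_one]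
    congr 1
    funext i
    have := (hspos i).ne'
    rw [← hss i]
    field_simp
  have hFU : F = U * diagonal s * Vᵀ := by
    have : U * diagonal s = F * V := by
      rw [hU, Matrix.mul_assoc, diagonal_mul_diagonal]
      have : (fun i => (s i)⁻¹ * s i) = fun _ => (1 : ℝ) := by
        funext i
        exact inv_mul_cancel₀ (hspos i).ne'
      rw [this, diagonal_one, Matrix.mul_one]
    rw [this, Matrix.mul_assoc, hVV', Matrix.mul_one]
  have hu2 : U.det * U.det = 1 := by
    have := congrArg det hUU
    simpa using this
  have hv2 : V.det * V.det = 1 := by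
    have := congrArg det hVV
    simpa using this
  have hdet : U.det * (s 0 * s 1 * s 2) * V.det = 1 := by
    have := congrArg det hFU
    rw [hF] at this
    simpa [Fin.prod_univ_three] using this.symm
  have hsp : 0 < s 0 * s 1 * s 2 := mul_pos (mul_pos (hspos 0) (hspos 1)) (hspos 2)
  have huv : U.det * V.det = 1 := by
    have h1 : (U.det * V.det) * (U.det * V.det) = 1 := by
      linear_combination hu2 * (V.det * V.det) + hv2
    rcases mul_self_eq_one_iff.1 h1 with h | h
    · exact h
    · nlinarith
  have hs1 : s 0 * s 1 * s 2 = 1 := by linear_combination hdet - (s 0 * s 1 * s 2) * huv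
  set e : Fin 3 → ℝ := ![U.det, 1, 1] with he
  have hee : diagonal e * diagonal s * diagonal e = diagonal s := by
    rw [diagonal_mul_diagonal, diagonal_mul_diagonal]
    congr 1
    funext i
    fin_cases i
    · simp only [he]
      simp
      linear_combination s 0 * hu2
    · simp [he]
    · simp [he]
  have hEE : diagonal e * diagonal e = (1 : Mat3) := by
    rw [diagonal_mul_diagonal, ← diagonal_one]
    congr 1
    funext i
    fin_cases i <;> simp [he, hu2]
  have hde : (diagonal e).det = U.det := by simp [he, Fin.prod_univ_three]
  refine ⟨⟨s, hs1⟩, U * diagonal e, mem_SO3_iff.2 ⟨?_, ?_⟩, diagonal e * Vᵀ,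
    mem_SO3_iff.2 ⟨?_, ?_⟩, ?_⟩
  · calc (U * diagonal e)ᵀ * (U * diagonal e) = diagonal e * (Uᵀ * U) * diagonal e := by
          simp only [transpose_mul, diagonal_transpose, Matrix.mul_assoc]
      _ = 1 := by rw [hUU, Matrix.mul_one, hEE]
  · rw [det_mul, hde, hu2]
  · calc (diagonal e * Vᵀ)ᵀ * (diagonal e * Vᵀ) = V * (diagonal e * diagonal e) * Vᵀ := by
          simp only [transpose_mul, diagonal_transpose, transpose_transpose, Matrix.mul_assoc]
      _ = 1 := by rw [hEE, Matrix.mul_one, hVV']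
  · rw [det_mul, hde, det_transpose, huv]
  · calc F = U * (diagonal e * diagonal s * diagonal e) * Vᵀ := by rw [hee]; exact hFU
      _ = _ := by simp only [Matrix.mul_assoc]

/-- The energy `Ψ^inc` on `{det F = 1}` that corresponds to `Ψt` on `{ν₁ ν₂ ν₃ = 1}`: its value
at `F` is the value of `Ψt` at signed singular values of `F`. For a `Π₃`-invariant `Ψt` the
choice of the latter does not matter, see `incEnergy_eq`. -/
def incEnergy (Ψt : IncSV → RInf) (F : IncMat) : RInf :=
  Ψt (exists_signedSV F).choose

theorem exists_perm_comp_eq (f g : Fin 3 → ℝ)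
    (h : Multiset.map f Finset.univ.val = Multiset.map g Finset.univ.val) :
    ∃ σ : Equiv.Perm (Fin 3), f = g ∘ σ := by
  have hp : (List.ofFn f).Perm (List.ofFn g) := by
    rw [← Multiset.coe_eq_coe, List.ofFn_eq_map, List.ofFn_eq_map]
    exact h
  have hs : f ∘ Tuple.sort f = g ∘ Tuple.sort g :=
    List.ofFn_injective <|
      ((((Tuple.sort f).ofFn_comp_perm f).trans hp).trans
        ((Tuple.sort g).ofFn_comp_perm g).symm).eq_of_pairwise'
        (Tuple.monotone_sort f).sortedLE_ofFn.pairwise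
        (Tuple.monotone_sort g).sortedLE_ofFn.pairwise
  refine ⟨(Tuple.sort f).symm.trans (Tuple.sort g), ?_⟩
  funext i
  simpa using congrFun hs ((Tuple.sort f).symm i)

/-- Signed singular values are unique up to `Π₃`. -/
theorem signedSV_unique {F : Mat3} {ν ν' : IncSV} (h : IsSignedSV F ν.1)
    (h' : IsSignedSV F ν'.1) : ∃ P ∈ Pi3, ν'.1 = P *ᵥ ν.1 := by
  have cp : ∀ ν : IncSV, IsSignedSV F ν.1 →
      (Fᵀ * F).charpoly.roots = Multiset.map (fun i => ν.1 i * ν.1 i) Finset.univ.val := by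
    rintro ν ⟨R₁, h₁, R₂, h₂, hF⟩
    have a := (mem_SO3_iff.1 h₁).1
    have b := mul_eq_one_comm.1 (mem_SO3_iff.1 h₂).1
    have e1 : Fᵀ * F = R₂ᵀ * diagonal (fun i => ν.1 i * ν.1 i) * R₂ := by
      calc Fᵀ * F = R₂ᵀ * diagonal ν.1 * (R₁ᵀ * R₁) * diagonal ν.1 * R₂ := by
            rw [hF]; simp only [transpose_mul, diagonal_transpose, Matrix.mul_assoc]
        _ = R₂ᵀ * (diagonal ν.1 * diagonal ν.1) * R₂ := by
            rw [a]; simp only [Matrix.mul_assoc, Matrix.one_mul]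
        _ = _ := by rw [diagonal_mul_diagonal]
    rw [e1, charpoly_mul_comm, ← Matrix.mul_assoc, b, Matrix.one_mul, charpoly_diagonal]
    rw [← Polynomial.roots_multiset_prod_X_sub_C
      (Multiset.map (fun i => ν.1 i * ν.1 i) Finset.univ.val)]
    congr 1
  have hm := (cp ν' h').symm.trans (cp ν h)
  obtain ⟨σ, hσ⟩ := exists_perm_comp_eq (fun i => ν'.1 i * ν'.1 i) (fun i => ν.1 i * ν.1 i) hm
  have hne : ∀ i, ν.1 i ≠ 0 := by
    intro i hi
    have := ν.2
    fin_cases i <;> simp_all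
  have hsq : ∀ i, ν'.1 i * ν'.1 i = ν.1 (σ i) * ν.1 (σ i) := fun i => congrFun hσ i
  set ε : Fin 3 → ℝ := fun j => ν'.1 (σ.symm j) / ν.1 j with hε
  have hεσ : ∀ i, ε (σ i) * ν.1 (σ i) = ν'.1 i := by
    intro i
    simp [hε, hne]
  refine ⟨σ.permMatrix ℝ * diagonal ε, ⟨σ, ε, ?_, ?_, rfl⟩, ?_⟩
  · intro j
    have := hsq (σ.symm j)
    rw [Equiv.apply_symm_apply] at this
    apply mul_self_eq_one_iff.1
    simp only [hε]
    rw [div_mul_div_comm, this]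
    exact div_self (mul_ne_zero (hne j) (hne j))
  · have h1 : ∏ i, ε (σ i) * ν.1 (σ i) = ∏ i, ε i * ν.1 i :=
      Equiv.prod_comp σ (fun i => ε i * ν.1 i)
    simp only [hεσ] at h1
    rw [Fin.prod_univ_three, Fin.prod_univ_three, ν'.2] at h1
    linear_combination -h1 - (ε 0 * ε 1 * ε 2) * ν.2
  · funext i
    rw [← mulVec_mulVec, permMatrix_mulVec]
    simp [mulVec_diagonal, hεσ]

theorem incEnergy_eq {Ψt : IncSV → RInf} (hinv : Pi3Invariant Ψt) (F : IncMat) (ν : IncSV)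
    (h : IsSignedSV F.1 ν.1) : incEnergy Ψt F = Ψt ν := by
  obtain ⟨P, hP, hν⟩ := signedSV_unique h (exists_signedSV F).choose_spec
  have e : (exists_signedSV F).choose = ⟨P *ᵥ ν.1, Pi3.mulVec_mem hP ν⟩ := Subtype.ext hν
  rw [incEnergy, e]
  exact hinv P hP ν

/-- `Ψt` is singular value polyconvex if the corresponding energy `Ψ^inc` is polyconvex. -/
def IncSingularValuePolyconvex (Ψt : IncSV → RInf) : Prop :=
  IncPolyconvex (incEnergy Ψt)

end

/-! Necessity is restriction to diagonal matrices. For sufficiency, let `Φ (F, G)` be the supremum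
of `f` at the diagonals of `R₁ F R₂` and `R₁ G R₂` over all rotations, and put `∞` where the
determinant variable is not `1`. Convexity and lower semicontinuity pass to suprema; the point is
that the supremum at `(F, cof F)` equals `Ψt ν` (`isLUB_rotDiag`). It is attained at the rotations
that diagonalize `F`. Otherwise the two diagonals are `M ν` and `M (cofVec ν)`, with `M` the
entrywise product of one rotation and the transpose of another. Such `M` lie in the convex hull of
`Π₃` (`hadamard_SO3_mem_convexHull_Pi3`), so convexity and invariance give the bound `Ψt ν`. The
hull statement follows from Birkhoff's theorem for `4 × 4` matrices, since `Π₃` is the symmetry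
group of a regular tetrahedron, and from the trace bound `-1` on `SO(3)`. -/

/-! ### Convexity and semicontinuity with values in `ℝ ∪ {∞}` -/

theorem RInf.coe_mul_mono {a : ℝ} (ha : 0 < a) {u v : RInf} (h : u ≤ v) :
    (a : RInf) * u ≤ (a : RInf) * v := by
  induction v using WithTop.recTopCoe with
  | top => rw [WithTop.mul_top (by exact_mod_cast ha.ne')]; exact le_top
  | coe v =>
    lift u to ℝ using ne_top_of_le_ne_top (WithTop.coe_ne_top) h
    have h' : u ≤ v := by exact_mod_cast h
    exact_mod_cast mul_le_mul_of_nonneg_left h' ha.le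

theorem ConvexRInf.convex_sublevel {E : Type*} [AddCommMonoid E] [Module ℝ E] {f : E → RInf}
    (hf : ConvexRInf f) (c : RInf) : Convex ℝ {x | f x ≤ c} := by
  rw [convex_iff_forall_pos]
  intro x hx y hy a b ha hb hab
  refine (hf x y a b ha hb hab).trans ((add_le_add (RInf.coe_mul_mono ha hx)
    (RInf.coe_mul_mono hb hy)).trans ?_)
  induction c using WithTop.recTopCoe with
  | top => exact le_top
  | coe c =>
    have : a * c + b * c ≤ c := by rw [← add_mul, hab, one_mul]
    exact_mod_cast this

theorem ConvexRInf.comp_linearMap {E E' : Type*} [AddCommMonoid E] [Module ℝ E]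
    [AddCommMonoid E'] [Module ℝ E'] {f : E' → RInf} (hf : ConvexRInf f) (L : E →ₗ[ℝ] E') :
    ConvexRInf (fun x => f (L x)) := by
  intro x y a b ha hb hab
  simpa using hf (L x) (L y) a b ha hb hab

theorem ConvexRInf.of_isLUB {ι E : Type*} [AddCommMonoid E] [SMul ℝ E] {f : ι → E → RInf}
    {g : E → RInf} (hf : ∀ i, ConvexRInf (f i))
    (hg : ∀ x, IsLUB (Set.range fun i => f i x) (g x)) : ConvexRInf g := by
  intro x y a b ha hb hab
  refine (hg _).2 ?_
  rintro _ ⟨i, rfl⟩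
  exact (hf i x y a b ha hb hab).trans (add_le_add
    (RInf.coe_mul_mono ha ((hg x).1 ⟨i, rfl⟩)) (RInf.coe_mul_mono hb ((hg y).1 ⟨i, rfl⟩)))

theorem lowerSemicontinuous_of_isLUB {ι E : Type*} [TopologicalSpace E] {f : ι → E → RInf}
    {g : E → RInf} (hf : ∀ i, LowerSemicontinuous (f i))
    (hg : ∀ x, IsLUB (Set.range fun i => f i x) (g x)) : LowerSemicontinuous g := by
  intro x y hy
  obtain ⟨_, ⟨i, rfl⟩, hi⟩ := (lt_isLUB_iff (hg x)).1 hy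
  filter_upwards [hf i x y hi] with x' hx'
  exact hx'.trans_le ((hg x').1 ⟨i, rfl⟩)

/-- The restriction of a function on `E` to the slice `E × {1}` of `E × ℝ`, extended by `∞`. -/
noncomputable def sliceOne {E : Type*} (f : E → RInf) (p : E × ℝ) : RInf :=
  open Classical in if p.2 = 1 then f p.1 else ⊤

theorem ConvexRInf.sliceOne {E : Type*} [AddCommMonoid E] [Module ℝ E] {f : E → RInf}
    (hf : ConvexRInf f) : ConvexRInf (sliceOne f) := by
  rintro ⟨x, s⟩ ⟨y, t⟩ a b ha hb hab
  -- Nonzero weights matter because `0 * ⊤ = 0`: off the slice the right-hand side must be `⊤`.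
  have ha' : (a : RInf) ≠ 0 := by exact_mod_cast ha.ne'
  have hb' : (b : RInf) ≠ 0 := by exact_mod_cast hb.ne'
  by_cases hs : s = 1
  · by_cases ht : t = 1
    · simpa [_root_.sliceOne, hs, ht, hab] using hf x y a b ha hb hab
    · simp [_root_.sliceOne, ht, WithTop.mul_top hb']
  · simp [_root_.sliceOne, hs, WithTop.mul_top ha']

theorem LowerSemicontinuous.sliceOne {E : Type*} [TopologicalSpace E] {f : E → RInf}
    (hf : LowerSemicontinuous f) : LowerSemicontinuous (sliceOne f) := by
  rintro ⟨x, s⟩ y hy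
  by_cases hs : s = 1
  · have h1 : y < f x := by simpa [_root_.sliceOne, hs] using hy
    have h2 : ∀ᶠ p : E × ℝ in nhds (x, s), y < f p.1 :=
      (continuous_fst.tendsto (x, s)).eventually (hf x y h1)
    filter_upwards [h2] with p hp
    by_cases h : p.2 = 1
    · simpa [_root_.sliceOne, h] using hp
    · simpa [_root_.sliceOne, h] using hp.trans_le le_top
  · have h2 : ∀ᶠ p : E × ℝ in nhds (x, s), p.2 ≠ 1 :=
      (continuous_snd.tendsto (x, s)).eventually (isOpen_ne.mem_nhds hs)
    filter_upwards [h2] with p hp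
    have : y < ⊤ := by simpa [_root_.sliceOne, hs] using hy
    simpa [_root_.sliceOne, hp] using this

/-! ### Rotations and cofactors -/

theorem adjugate_of_mem_SO3 {R : Mat3} (hR : R ∈ specialOrthogonalGroup (Fin 3) ℝ) :
    adjugate R = Rᵀ := by
  obtain ⟨h1, h2⟩ := mem_SO3_iff.1 hR
  calc adjugate R = Rᵀ * R * adjugate R := by rw [h1, Matrix.one_mul]
    _ = Rᵀ := by rw [Matrix.mul_assoc, mul_adjugate, h2, one_smul, Matrix.mul_one]

theorem transpose_mem_SO3 {R : Mat3} (hR : R ∈ specialOrthogonalGroup (Fin 3) ℝ) :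
    Rᵀ ∈ specialOrthogonalGroup (Fin 3) ℝ := by
  obtain ⟨h1, h2⟩ := mem_SO3_iff.1 hR
  exact mem_SO3_iff.2 ⟨by rw [transpose_transpose, mul_eq_one_comm.1 h1], by rw [det_transpose, h2]⟩

theorem cof_mul (A B : Mat3) : cof (A * B) = cof A * cof B := by
  rw [cof, adjugate_mul_distrib, transpose_mul, cof, cof]

theorem cof_of_mem_SO3 {R : Mat3} (hR : R ∈ specialOrthogonalGroup (Fin 3) ℝ) : cof R = R := by
  rw [cof, adjugate_of_mem_SO3 hR, transpose_transpose]

/-- The vector of the complementary products `(ν₂ν₃, ν₁ν₃, ν₁ν₂)`. -/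
def cofVec (ν : Fin 3 → ℝ) : Fin 3 → ℝ := ![ν 1 * ν 2, ν 0 * ν 2, ν 0 * ν 1]

theorem cof_diagonal (ν : Fin 3 → ℝ) : cof (diagonal ν) = diagonal (cofVec ν) := by
  ext i j
  fin_cases i <;> fin_cases j <;> simp [cof, adjugate_fin_three, cofVec, diagonal]

theorem neg_one_le_trace_of_mem_SO3 {R : Mat3} (hR : R ∈ specialOrthogonalGroup (Fin 3) ℝ) :
    -1 ≤ R.trace := by
  have hadj := adjugate_of_mem_SO3 hR
  have h1 := (mem_SO3_iff.1 hR).1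
  have c0 := congrFun (congrFun hadj 0) 0
  have c1 := congrFun (congrFun hadj 1) 1
  have c2 := congrFun (congrFun hadj 2) 2
  have n0 := congrFun (congrFun h1 0) 0
  have n1 := congrFun (congrFun h1 1) 1
  have n2 := congrFun (congrFun h1 2) 2
  simp [adjugate_fin_three] at c0 c1 c2
  simp [Matrix.mul_apply, Fin.sum_univ_three] at n0 n1 n2
  rw [Matrix.trace_fin_three]
  -- For rotation angle `θ` the trace is `1 + 2 cos θ`, and both sides equal `4 sin² θ`.
  have key : (1 + (R 0 0 + R 1 1 + R 2 2)) * (3 - (R 0 0 + R 1 1 + R 2 2)) =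
      (R 2 1 - R 1 2) ^ 2 + (R 0 2 - R 2 0) ^ 2 + (R 1 0 - R 0 1) ^ 2 := by
    linear_combination (-2) * (c0 + c1 + c2) - n0 - n1 - n2
  by_contra! hlt
  nlinarith [sq_nonneg (R 2 1 - R 1 2), sq_nonneg (R 0 2 - R 2 0), sq_nonneg (R 1 0 - R 0 1)]

/-! ### The tetrahedron and the convex hull of `Π₃` -/

/-- The vertices of a regular tetrahedron. -/
def tetraVertex : Fin 4 → Fin 3 → ℤ :=
  ![![1, 1, 1], ![1, -1, -1], ![-1, 1, -1], ![-1, -1, 1]]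

theorem diagonal_tetraVertex_mem_SO3 (k : Fin 4) :
    diagonal (fun i => (tetraVertex k i : ℝ)) ∈ specialOrthogonalGroup (Fin 3) ℝ := by
  rw [mem_SO3_iff]
  constructor
  · rw [diagonal_transpose, diagonal_mul_diagonal, ← diagonal_one]
    congr 1
    funext i
    fin_cases k <;> fin_cases i <;> simp [tetraVertex]
  · fin_cases k <;> simp [tetraVertex, Fin.prod_univ_three]

/-- The permutations of the vertices of the tetrahedron act by signed permutations of the
coordinates. -/
theorem exists_signedPerm_of_perm_tetraVertex (σ : Equiv.Perm (Fin 4)) :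
    ∃ (τ : Equiv.Perm (Fin 3)) (ε : Fin 3 → ℤˣ), ε 0 * ε 1 * ε 2 = 1 ∧
      -- Integer coordinates make this a decidable check over 24 permutations.
      ∀ i j, ∑ k, tetraVertex k i * tetraVertex (σ k) j = if τ i = j then 4 * (ε j : ℤ) else 0 := by
  revert σ
  decide

/-- The compression of a `4 × 4` matrix to the span of the coordinate functions on the
tetrahedron. -/
noncomputable def tetraCompress : Matrix (Fin 4) (Fin 4) ℝ →ₗ[ℝ] Mat3 where
  toFun D := of fun i j => (1 / 4) * ∑ k, ∑ l, (tetraVertex k i : ℝ) * D k l * tetraVertex l j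
  map_add' D D' := by
    ext i j
    simp only [of_apply, Matrix.add_apply, mul_add, add_mul, Finset.sum_add_distrib]
  map_smul' c D := by
    ext i j
    simp only [of_apply, Matrix.smul_apply, smul_eq_mul, Finset.mul_sum, RingHom.id_apply]
    refine Finset.sum_congr rfl fun k _ => Finset.sum_congr rfl fun l _ => ?_
    ring

theorem tetraCompress_permMatrix_mem (σ : Equiv.Perm (Fin 4)) :
    tetraCompress (σ.permMatrix ℝ) ∈ Pi3 := by
  obtain ⟨τ, ε, hε, h⟩ := exists_signedPerm_of_perm_tetraVertex σ
  refine ⟨τ, fun j => ((ε j : ℤ) : ℝ), fun i => ?_, ?_, ?_⟩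
  · rcases Int.units_eq_one_or (ε i) with h | h <;> simp [h]
  · have h' : ((ε 0 * ε 1 * ε 2 : ℤˣ) : ℤ) = 1 := congrArg Units.val hε
    rw [Units.val_mul, Units.val_mul] at h'
    beta_reduce
    exact_mod_cast congrArg (Int.cast (R := ℝ)) h'
  · ext i j
    have h' : (∑ k, (tetraVertex k i : ℝ) * tetraVertex (σ k) j) =
        if τ i = j then 4 * ((ε j : ℤ) : ℝ) else 0 := by
      exact_mod_cast congrArg (Int.cast (R := ℝ)) (h i j)
    simp [tetraCompress, Equiv.Perm.permMatrix, PEquiv.toMatrix_apply, h', mul_diagonal]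

/-- The hypotheses are exactly nonnegativity of the entries of a `4 × 4` matrix `D` with unit row
and column sums. Birkhoff's theorem writes `D` as a mixture of vertex permutations, and compression
sends these into `Π₃`. -/
theorem mem_convexHull_Pi3 {M : Mat3}
    (hM : ∀ k l, -1 ≤ ∑ i, ∑ j, (tetraVertex k i : ℝ) * M i j * tetraVertex l j) :
    M ∈ convexHull ℝ Pi3 := by
  set D : Matrix (Fin 4) (Fin 4) ℝ :=
    of fun k l => (1 / 4) * (1 + ∑ i, ∑ j, (tetraVertex k i : ℝ) * M i j * tetraVertex l j) with hD
  have hDS : D ∈ doublyStochastic ℝ (Fin 4) := by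
    rw [mem_doublyStochastic_iff_sum]
    refine ⟨fun k l => ?_, fun k => ?_, fun l => ?_⟩
    · have := hM k l
      simp only [hD, of_apply]
      linarith
    · simp only [hD, of_apply, Fin.sum_univ_four, Fin.sum_univ_three, tetraVertex]
      simp
      ring
    · simp only [hD, of_apply, Fin.sum_univ_four, Fin.sum_univ_three, tetraVertex]
      simp
      ring
  -- The vertices sum to zero, which kills the constant term, and the coordinate functions are
  -- orthogonal with squared norm `4`.
  have hMD : M = tetraCompress D := by
    ext i j
    simp only [tetraCompress, LinearMap.coe_mk, AddHom.coe_mk, hD, of_apply, Fin.sum_univ_four,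
      Fin.sum_univ_three, tetraVertex]
    fin_cases i <;> fin_cases j <;> simp <;> ring
  have hsub : (doublyStochastic ℝ (Fin 4) : Set (Matrix (Fin 4) (Fin 4) ℝ)) ⊆
      tetraCompress ⁻¹' convexHull ℝ Pi3 := by
    rw [doublyStochastic_eq_convexHull_permMatrix]
    refine convexHull_min ?_ ((convex_convexHull ℝ Pi3).linear_preimage tetraCompress)
    rintro _ ⟨σ, rfl⟩
    exact subset_convexHull ℝ _ (tetraCompress_permMatrix_mem σ)
  rw [hMD]
  exact hsub hDS

/-- Each required inequality is the trace bound for the rotation `diag(v_k) A diag(v_l) B`, with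
`v_k`, `v_l` tetrahedron vertices. -/
theorem hadamard_SO3_mem_convexHull_Pi3 {A B : Mat3}
    (hA : A ∈ specialOrthogonalGroup (Fin 3) ℝ) (hB : B ∈ specialOrthogonalGroup (Fin 3) ℝ) :
    (of fun i j => A i j * B j i : Mat3) ∈ convexHull ℝ Pi3 := by
  refine mem_convexHull_Pi3 fun k l => ?_
  have h := neg_one_le_trace_of_mem_SO3 (mul_mem (mul_mem (mul_mem
    (diagonal_tetraVertex_mem_SO3 k) hA) (diagonal_tetraVertex_mem_SO3 l)) hB)
  refine h.trans_eq ?_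
  simp only [Matrix.trace, diag_apply]
  refine Finset.sum_congr rfl fun i _ => ?_
  rw [Matrix.mul_apply]
  refine Finset.sum_congr rfl fun j _ => ?_
  rw [mul_diagonal, diagonal_mul, of_apply]
  ring

/-! ### Sufficiency: the supremum over rotations -/

/-- Concatenation of two triples. -/
def joinTriples : (Fin 3 → ℝ) × (Fin 3 → ℝ) →ₗ[ℝ] (Fin 6 → ℝ) where
  toFun p := ![p.1 0, p.1 1, p.1 2, p.2 0, p.2 1, p.2 2]
  map_add' p q := by ext i; fin_cases i <;> simp
  map_smul' c p := by ext i; fin_cases i <;> simp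

/-- On `ν₁ν₂ν₃ = 1`, `cofVec` is entrywise inversion, which commutes with permutations and with
signs. -/
theorem cofVec_mulVec {P : Mat3} (hP : P ∈ Pi3) (ν : IncSV) :
    cofVec (P *ᵥ ν.1) = P *ᵥ cofVec ν.1 := by
  have inv : ∀ μ : Fin 3 → ℝ, μ 0 * μ 1 * μ 2 = 1 → ∀ i, μ i * cofVec μ i = 1 := by
    intro μ hμ i
    fin_cases i <;> simp [cofVec] <;> linarith
  have hp := inv _ (Pi3.mulVec_mem hP ν)
  have hn := inv _ ν.2
  obtain ⟨σ, ε, hε, -, rfl⟩ := hP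
  have key : ∀ (μ : Fin 3 → ℝ) i,
      ((σ.permMatrix ℝ * diagonal ε) *ᵥ μ) i = ε (σ i) * μ (σ i) := by
    intro μ i
    rw [← mulVec_mulVec, permMatrix_mulVec]
    simp [mulVec_diagonal]
  funext i
  have h1 := hp i
  have h2 := hn (σ i)
  have h3 : ε (σ i) * ε (σ i) = 1 := mul_self_eq_one_iff.2 (hε (σ i))
  rw [key] at h1 ⊢
  set x := cofVec ((σ.permMatrix ℝ * diagonal ε) *ᵥ ν.1) i
  linear_combination (ε (σ i) * cofVec ν.1 (σ i)) * h1 - x * h2 -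
    (x * ν.1 (σ i) * cofVec ν.1 (σ i)) * h3

theorem le_of_mem_convexHull_Pi3 {Ψt : IncSV → RInf} (hΨ : Pi3Invariant Ψt)
    {f : (Fin 6 → ℝ) → RInf} (hf : ConvexRInf f)
    (h : ∀ ν : IncSV, Ψt ν = f (joinTriples (ν.1, cofVec ν.1))) (ν : IncSV) {M : Mat3}
    (hM : M ∈ convexHull ℝ Pi3) :
    f (joinTriples (M *ᵥ ν.1, M *ᵥ cofVec ν.1)) ≤ Ψt ν := by
  let L : Mat3 →ₗ[ℝ] (Fin 6 → ℝ) := joinTriples ∘ₗ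
    (((Matrix.mulVecBilin ℝ ℝ).flip ν.1).prod ((Matrix.mulVecBilin ℝ ℝ).flip (cofVec ν.1)))
  have hc : Convex ℝ {M : Mat3 | f (L M) ≤ Ψt ν} := (hf.comp_linearMap L).convex_sublevel _
  refine convexHull_min (fun P hP => ?_) hc hM
  change f (joinTriples (P *ᵥ ν.1, P *ᵥ cofVec ν.1)) ≤ Ψt ν
  rw [← cofVec_mulVec hP, ← hΨ P hP ν, h]

/-- The pairs of rotations. -/
abbrev RotPair : Type :=
  specialOrthogonalGroup (Fin 3) ℝ × specialOrthogonalGroup (Fin 3) ℝ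

/-- The diagonals of `R₁ F R₂` and `R₁ G R₂` as a function of `(F, G)`. -/
def rotDiag (R : RotPair) : Mat3 × Mat3 →ₗ[ℝ] (Fin 6 → ℝ) where
  toFun p := joinTriples (diag (R.1.1 * p.1 * R.2.1), diag (R.1.1 * p.2 * R.2.1))
  map_add' p q := by
    rw [← joinTriples.map_add]
    simp [Matrix.mul_add, Matrix.add_mul]
  map_smul' c p := by
    rw [RingHom.id_apply, ← joinTriples.map_smul]
    simp

theorem diag_mul_diagonal_mul (A B : Mat3) (ν : Fin 3 → ℝ) :
    diag (A * diagonal ν * B) = (of fun i j => A i j * B j i) *ᵥ ν := by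
  funext i
  rw [diag_apply, Matrix.mul_apply, Matrix.mulVec, dotProduct]
  refine Finset.sum_congr rfl fun j _ => ?_
  rw [mul_diagonal, of_apply]
  ring

theorem isLUB_rotDiag {Ψt : IncSV → RInf} (hΨ : Pi3Invariant Ψt)
    {f : (Fin 6 → ℝ) → RInf} (hf : ConvexRInf f)
    (h : ∀ ν : IncSV, Ψt ν = f (joinTriples (ν.1, cofVec ν.1))) {F : Mat3} {ν : IncSV}
    (hF : IsSignedSV F ν.1) :
    IsLUB (Set.range fun R : RotPair => f (rotDiag R (F, cof F))) (Ψt ν) := by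
  obtain ⟨R₁, h₁, R₂, h₂, rfl⟩ := hF
  have hc : cof (R₁ * diagonal ν.1 * R₂) = R₁ * diagonal (cofVec ν.1) * R₂ := by
    rw [cof_mul, cof_mul, cof_of_mem_SO3 h₁, cof_of_mem_SO3 h₂, cof_diagonal]
  have assoc : ∀ A B D : Mat3, A * (R₁ * D * R₂) * B = (A * R₁) * D * (R₂ * B) := fun A B D => by
    simp only [Matrix.mul_assoc]
  rw [hc]
  constructor
  · rintro _ ⟨R, rfl⟩
    change f (joinTriples (diag (R.1.1 * _ * R.2.1), diag (R.1.1 * _ * R.2.1))) ≤ Ψt ν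
    rw [assoc, assoc, diag_mul_diagonal_mul, diag_mul_diagonal_mul]
    exact le_of_mem_convexHull_Pi3 hΨ hf h ν
      (hadamard_SO3_mem_convexHull_Pi3 (mul_mem R.1.2 h₁) (mul_mem h₂ R.2.2))
  · intro c hc
    refine le_trans (le_of_eq ?_) (hc ⟨(⟨R₁ᵀ, transpose_mem_SO3 h₁⟩, ⟨R₂ᵀ, transpose_mem_SO3 h₂⟩),
      rfl⟩)
    change _ = f (joinTriples (diag (R₁ᵀ * _ * R₂ᵀ), diag (R₁ᵀ * _ * R₂ᵀ)))
    rw [assoc, assoc, (mem_SO3_iff.1 h₁).1, mul_eq_one_comm.1 (mem_SO3_iff.1 h₂).1]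
    simp only [Matrix.one_mul, Matrix.mul_one, diag_diagonal]
    exact h ν

theorem incSingularValuePolyconvex_of_convex {Ψt : IncSV → RInf} (hΨ : Pi3Invariant Ψt)
    {f : (Fin 6 → ℝ) → RInf} (hf : ConvexRInf f) (hlsc : LowerSemicontinuous f)
    (h : ∀ ν : IncSV, Ψt ν = f (joinTriples (ν.1, cofVec ν.1))) :
    IncSingularValuePolyconvex Ψt := by
  set Φ : Mat3 × Mat3 → RInf := fun p => sSup (Set.range fun R : RotPair => f (rotDiag R p))
  have hΦ : ∀ p, IsLUB (Set.range fun R : RotPair => f (rotDiag R p)) (Φ p) := fun p =>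
    -- `RInf` has no least element, so nonemptiness of the family is essential.
    WithTop.isLUB_sSup' (Set.range_nonempty _)
  have hΦconv : ConvexRInf Φ := ConvexRInf.of_isLUB (fun R => hf.comp_linearMap (rotDiag R)) hΦ
  have hΦlsc : LowerSemicontinuous Φ := lowerSemicontinuous_of_isLUB
    (fun R => hlsc.comp (rotDiag R).continuous_of_finiteDimensional) hΦ
  let e : Mat3 × Mat3 × ℝ →ₗ[ℝ] (Mat3 × Mat3) × ℝ :=
    (LinearEquiv.prodAssoc ℝ Mat3 Mat3 ℝ).symm
  refine ⟨fun p => sliceOne Φ (e p), hΦconv.sliceOne.comp_linearMap e,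
    hΦlsc.sliceOne.comp e.continuous_of_finiteDimensional, fun F => ?_⟩
  change _ = sliceOne Φ ((F, cof F), F.det)
  by_cases hF : F.det = 1
  · obtain ⟨ν, hν⟩ := exists_signedSV ⟨F, hF⟩
    have e1 : extendByTop (incEnergy Ψt) F = Ψt ν := by
      rw [extendByTop, dif_pos hF, incEnergy_eq hΨ _ ν hν]
    rw [e1, sliceOne, if_pos hF]
    exact (isLUB_rotDiag hΨ hf h hν).unique (hΦ _)
  · rw [extendByTop, dif_neg hF, sliceOne, if_neg hF]

/-! ### Necessity: restriction to diagonal matrices -/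

/-- The two halves of a vector of length six as diagonal matrices. -/
def diagPair : (Fin 6 → ℝ) →ₗ[ℝ] Mat3 × Mat3 where
  toFun v := (diagonal ![v 0, v 1, v 2], diagonal ![v 3, v 4, v 5])
  map_add' v w := by ext i j <;> fin_cases i <;> fin_cases j <;> simp
  map_smul' c v := by ext i j <;> fin_cases i <;> fin_cases j <;> simp

theorem incEnergy_diagonal {Ψt : IncSV → RInf} (hΨ : Pi3Invariant Ψt) (ν : IncSV) :
    extendByTop (incEnergy Ψt) (diagonal ν.1) = Ψt ν := by
  have hd : (diagonal ν.1).det = 1 := by rw [det_diagonal, Fin.prod_univ_three, ν.2]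
  rw [extendByTop, dif_pos hd]
  exact incEnergy_eq hΨ _ ν ⟨1, one_mem _, 1, one_mem _, by simp⟩

theorem IncSingularValuePolyconvex.exists_convex {Ψt : IncSV → RInf} (hΨ : Pi3Invariant Ψt)
    (h : IncSingularValuePolyconvex Ψt) :
    ∃ f : (Fin 6 → ℝ) → RInf, ConvexRInf f ∧ LowerSemicontinuous f ∧
      ∀ ν : IncSV, Ψt ν = f (joinTriples (ν.1, cofVec ν.1)) := by
  obtain ⟨g, hg, hlsc, hgF⟩ := h
  -- Freezing the determinant at `1` is affine, not linear; convexity survives because the weights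
  -- sum to `1`.
  refine ⟨fun v => g ((diagPair v).1, (diagPair v).2, 1), fun v w a b ha hb hab => ?_,
    hlsc.comp ?_, fun ν => ?_⟩
  · simpa [hab] using hg ((diagPair v).1, (diagPair v).2, 1) ((diagPair w).1, (diagPair w).2, 1)
      a b ha hb hab
  · have := diagPair.continuous_of_finiteDimensional
    fun_prop
  · have hd : (diagonal ν.1).det = 1 := by rw [det_diagonal, Fin.prod_univ_three, ν.2]
    have hν : diagPair (joinTriples (ν.1, cofVec ν.1)) = (diagonal ν.1, diagonal (cofVec ν.1)) := by
      ext i j <;> fin_cases i <;> fin_cases j <;> simp [diagPair, joinTriples]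
    have := hgF (diagonal ν.1)
    rw [incEnergy_diagonal hΨ, cof_diagonal, hd] at this
    simpa only [hν] using this

theorem mainTheorem2 (Ψt : IncSV → RInf) (hΨ : Pi3Invariant Ψt) :
    IncSingularValuePolyconvex Ψt ↔
      ∃ Ψssv : (Fin 6 → ℝ) → RInf, ConvexRInf Ψssv ∧ LowerSemicontinuous Ψssv ∧
        ∀ ν : IncSV, Ψt ν = Ψssv ![ν.1 0, ν.1 1, ν.1 2,
          ν.1 1 * ν.1 2, ν.1 0 * ν.1 2, ν.1 0 * ν.1 1] :=
  ⟨fun h => h.exists_convex hΨ, fun ⟨_, hf, hlsc, h⟩ =>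
    incSingularValuePolyconvex_of_convex hΨ hf hlsc h⟩
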